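/- Let $q,p\in\mathbb C$ with $q\neq 0$ and $|p|<1$. Put $$\theta(x;p)=\prod_{j=0}^\infty(1-p^jx)(1-p^{j+1}/x),\qquad (a;q,p)_k=\prod_{j=0}^{k-1}\theta(aq^j;p),$$ $$h_k(x;a)=(a\xi;q,p)_k\,(a\xi^{-1};q,p)_k,\qquad \xi+\xi^{-1}=x,$$ where $h_k(x;a)$ is a function of $x\in\mathbb C$ (it does not depend on the choice of $\xi$). For $p=0$ we have $\theta(x;0)=1-x$, and $a=0$ is then allowed as well. Let $N,m,n$ be non-negative integers and $a,b\in\mathbb C$, with $a,b\neq0$ if $p\neq0$. Put $c=aq^m$ and $d=bq^n$, and assume that the parameters are generic in the sense that $$p^jc\neq q^sd\quad(1-N\le s\le N-1),\qquad p^jcd\neq q^s\quad(1-N\leq s\leq 0)$$ for all integers $s$ in the indicated ranges and all $j\in\mathbb Z$ (only $j=0$ if $p=0$). Then: 1. For every $0\le k\le N$, $$h_k(x;a)h_{N-k}(x;b)\in\operatorname{span}_{\mathbb C}\{h_l(x;aq^m)h_{N-l}(x;bq^n):\ 0\le l\le N,\ k-m\leq l\leq k+n\}.$$ 2. The elliptic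 $6j$-coefficients $R_k^l=R_k^l(a,b,aq^m,bq^n;N;q,p)$, $0\le k,l\le N$, defined by $$h_k(x;a)h_{N-k}(x;b)=\sum_{l=0}^N R_k^l\,h_l(x;aq^m)h_{N-l}(x;bq^n)\quad\text{for all }x\in\mathbb C,$$ exist uniquely, and have the band structure $R_k^l=0$ unless $k-m\leq l\leq k+n$. -/

import Mathlib

namespace EllipticSixJ

/-- The theta function `θ(x;p) = ∏_{j ≥ 0} (1 - p^j x)(1 - p^{j+1}/x)`, for `|p| < 1`. -/
noncomputable def theta (p x : ℂ) : ℂ :=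
  ∏' j : ℕ, ((1 - p ^ j * x) * (1 - p ^ (j + 1) / x))

/-- The infinite product defining `theta` converges absolutely. -/
theorem multipliable_theta {p : ℂ} (hp : ‖p‖ < 1) (x : ℂ) :
    Multipliable fun j : ℕ => (1 - p ^ j * x) * (1 - p ^ (j + 1) / x) := by
  have hs : Summable fun j : ℕ => ‖p‖ ^ j :=
    summable_geometric_of_lt_one (norm_nonneg p) hp
  refine Multipliable.mul ?_ ?_
  · have h : Summable fun j : ℕ => ‖-(p ^ j * x)‖ := by
      simpa [norm_mul, norm_pow] using hs.mul_right ‖x‖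
    simpa [sub_eq_add_neg] using multipliable_one_add_of_summable h
  · have h : Summable fun j : ℕ => ‖-(p ^ (j + 1) / x)‖ := by
      have := (hs.mul_right (‖p‖ / ‖x‖))
      refine this.congr fun j => ?_
      rw [norm_neg, norm_div, norm_pow, pow_succ]
      ring
    simpa [sub_eq_add_neg] using multipliable_one_add_of_summable h

/-- The elliptic shifted factorial `(a;q,p)_k = ∏_{j=0}^{k-1} θ(a q^j; p)`. -/
noncomputable def ellFact (q p a : ℂ) (k : ℕ) : ℂ :=
  ∏ j ∈ Finset.range k, theta p (a * q ^ j)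

theorem exists_xi (x : ℂ) : ∃ ξ : ℂ, ξ ≠ 0 ∧ ξ + ξ⁻¹ = x := by
  obtain ⟨s, hs⟩ := IsAlgClosed.exists_pow_nat_eq (x ^ 2 - 4) (n := 2) (by norm_num)
  have h1 : (x + s) / 2 * ((x - s) / 2) = 1 := by linear_combination (-1 / 4) * hs
  refine ⟨(x + s) / 2, left_ne_zero_of_mul_eq_one h1, ?_⟩
  rw [inv_eq_of_mul_eq_one_right h1]
  ring

/-- A nonzero `ξ` with `ξ + ξ⁻¹ = x`; it is determined up to `ξ ↦ ξ⁻¹`. -/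
noncomputable def xi (x : ℂ) : ℂ := (exists_xi x).choose

theorem xi_ne_zero (x : ℂ) : xi x ≠ 0 := (exists_xi x).choose_spec.1

theorem xi_add_inv (x : ℂ) : xi x + (xi x)⁻¹ = x := (exists_xi x).choose_spec.2

/-- `h_k(x;a) = h_k(x;a;q,p) = (aξ, aξ⁻¹; q,p)_k`, where `ξ + ξ⁻¹ = x`,
as a function of `x`. -/
noncomputable def h (q p : ℂ) (k : ℕ) (a x : ℂ) : ℂ :=
  ellFact q p (a * xi x) k * ellFact q p (a * (xi x)⁻¹) k

/-- `h` does not depend on the choice of `ξ`. -/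
theorem h_add_inv (q p : ℂ) (k : ℕ) (a : ℂ) {ξ : ℂ} (hξ : ξ ≠ 0) :
    h q p k a (ξ + ξ⁻¹) = ellFact q p (a * ξ) k * ellFact q p (a * ξ⁻¹) k := by
  have h0 := xi_ne_zero (ξ + ξ⁻¹)
  have h1 := xi_add_inv (ξ + ξ⁻¹)
  unfold h
  generalize xi (ξ + ξ⁻¹) = η at h0 h1
  have h2 : (η - ξ) * (η - ξ⁻¹) = 0 := by
    linear_combination η * h1 + mul_inv_cancel₀ hξ - mul_inv_cancel₀ h0
  rcases mul_eq_zero.mp h2 with h3 | h3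
  · rw [sub_eq_zero.mp h3]
  · rw [sub_eq_zero.mp h3, inv_inv, mul_comm]

/-- The function `x ↦ h_k(x;a) h_{N-k}(x;b)` (used for `k ≤ N`). -/
noncomputable def hh (q p : ℂ) (N k : ℕ) (a b : ℂ) : ℂ → ℂ :=
  fun x => h q p k a x * h q p (N - k) b x

/-- The matrix `R = (R_k^l(a,b,c,d;N;q,p))`, `0 ≤ k, l ≤ N`, is a matrix of elliptic
`6j`-coefficients:
`h_k(x;a) h_{N-k}(x;b) = ∑_{l=0}^N R_k^l h_l(x;c) h_{N-l}(x;d)` identically in `x`. -/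
def IsSixJ (q p : ℂ) (N : ℕ) (a b c d : ℂ) (R : Fin (N + 1) → Fin (N + 1) → ℂ) : Prop :=
  ∀ (k : Fin (N + 1)) (x : ℂ),
    hh q p N k a b x = ∑ l : Fin (N + 1), R k l * hh q p N l c d x

end EllipticSixJ

namespace EllipticSixJ

/-! Write `φ(x;a) = θ(aξ)θ(aξ⁻¹)`, so that `h_k(x;a)` is the product of `φ(x;aq^j)` over `j < k`.
The key fact is that all the functions `φ(·;a)` lie in a two-dimensional space, in which `φ(·;b)`
and `φ(·;c)` form a basis for `b`, `c` in general position (`exists_thetaPair_eq`). For `p = 0` they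
are polynomials of degree at most one in `x`; for `p ≠ 0` the rank-two property follows from
Jacobi's triple product by multiplying two theta series and splitting the double sum by parity.

Expanding one factor at a time, any product of `M` functions `φ` lies in the span of the
`h_l(·;c)h_{M-l}(·;d)` (`prod_thetaPair_mem_span`). Applied to Lagrange-type products, this also
gives linear independence (`linearIndependent_hh`), hence uniqueness.

For the band structure, `h_k(·;a)` and `h_k(·;aq^m)` share all but `m` of their factors, and
similarly for `b`. Pull the shared factors out and expand only the remaining ones, at most `m + n`
in number (`hh_mem_span`). -/

open Filter Topology

/-! ### Euler products and their limits -/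

/-- The finite product `(p;p)_n = ∏_{1 ≤ i ≤ n} (1 - p^i)`. -/
noncomputable def eulerProd (p : ℂ) (n : ℕ) : ℂ :=
  ∏ i ∈ Finset.range n, (1 - p ^ (i + 1))

/-- The reciprocal of `(p;p)_k`, extended by zero to negative `k`. -/
noncomputable def invEulerProd (p : ℂ) (k : ℤ) : ℂ :=
  if 0 ≤ k then (eulerProd p k.toNat)⁻¹ else 0

theorem one_sub_pow_ne_zero {p : ℂ} (hp : ‖p‖ < 1) {i : ℕ} (hi : i ≠ 0) : 1 - p ^ i ≠ 0 := by
  intro h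
  have h1 : ‖p‖ ^ i = 1 := by rw [← norm_pow, ← sub_eq_zero.mp h, norm_one]
  exact (pow_lt_one₀ (norm_nonneg p) hp hi).ne h1

theorem eulerProd_ne_zero {p : ℂ} (hp : ‖p‖ < 1) (n : ℕ) : eulerProd p n ≠ 0 :=
  Finset.prod_ne_zero_iff.mpr fun i _ => one_sub_pow_ne_zero hp (Nat.succ_ne_zero i)

theorem invEulerProd_natCast (p : ℂ) (n : ℕ) : invEulerProd p n = (eulerProd p n)⁻¹ := by
  simp [invEulerProd]

theorem invEulerProd_of_neg (p : ℂ) {k : ℤ} (hk : k < 0) : invEulerProd p k = 0 := by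
  simp [invEulerProd, hk]

/-- Extension by zero keeps the recurrence valid for every integer `k`: at `k = 0` the factor `1 -
p^0` vanishes. Sums over all of `ℤ` then need no boundary cases. -/
theorem invEulerProd_sub_one {p : ℂ} (hp : ‖p‖ < 1) (k : ℤ) :
    invEulerProd p (k - 1) = (1 - p ^ k) * invEulerProd p k := by
  rcases lt_trichotomy k 0 with hk | rfl | hk
  · rw [invEulerProd_of_neg p hk, invEulerProd_of_neg p (by lia), mul_zero]
  · rw [invEulerProd_of_neg p (by lia)]
    simp
  · obtain ⟨n, rfl⟩ : ∃ n : ℕ, k = ((n + 1 : ℕ) : ℤ) := ⟨(k - 1).toNat, by lia⟩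
    have h1 : (((n + 1 : ℕ) : ℤ) - 1) = (n : ℤ) := by push_cast; ring
    rw [h1, invEulerProd_natCast, invEulerProd_natCast, zpow_natCast, eulerProd, eulerProd,
      Finset.prod_range_succ, mul_inv, mul_comm (1 - _), mul_assoc,
      inv_mul_cancel₀ (one_sub_pow_ne_zero hp (Nat.succ_ne_zero n)), mul_one]

/-- The limit `(p;p)_∞` is nonzero. -/
theorem exists_tendsto_eulerProd {p : ℂ} (hp : ‖p‖ < 1) :
    ∃ e : ℂ, e ≠ 0 ∧ Tendsto (eulerProd p) atTop (𝓝 e) := by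
  have hs : Summable fun i : ℕ => ‖-p ^ (i + 1)‖ := by
    simp only [norm_neg, norm_pow]
    exact (summable_nat_add_iff 1).mpr (summable_geometric_of_lt_one (norm_nonneg p) hp)
  refine ⟨∏' i : ℕ, (1 + -p ^ (i + 1)), tprod_one_add_ne_zero_of_summable (fun i => ?_) hs, ?_⟩
  · rw [← sub_eq_add_neg]
    exact one_sub_pow_ne_zero hp (Nat.succ_ne_zero i)
  · refine (multipliable_one_add_of_summable hs).tendsto_prod_tprod_nat.congr fun n => ?_
    simp only [eulerProd, sub_eq_add_neg]

theorem tendsto_invEulerProd {p e : ℂ} (he : e ≠ 0)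
    (h : Tendsto (eulerProd p) atTop (𝓝 e)) : Tendsto (invEulerProd p) atTop (𝓝 e⁻¹) := by
  have h1 : Tendsto Int.toNat atTop atTop :=
    tendsto_atTop.mpr fun n => (eventually_ge_atTop (n : ℤ)).mono fun k hk => by lia
  refine ((h.inv₀ he).comp h1).congr' ?_
  filter_upwards [eventually_ge_atTop 0] with k hk
  simp [invEulerProd, hk]

theorem exists_norm_invEulerProd_le {p : ℂ} (hp : ‖p‖ < 1) :
    ∃ C : ℝ, 0 ≤ C ∧ ∀ k, ‖invEulerProd p k‖ ≤ C := by
  obtain ⟨e, he, h⟩ := exists_tendsto_eulerProd hp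
  obtain ⟨C, hC⟩ := (Metric.isBounded_range_of_tendsto _ (h.inv₀ he)).exists_norm_le
  have hC0 : 0 ≤ C := (norm_nonneg _).trans (hC _ ⟨0, rfl⟩)
  refine ⟨C, hC0, fun k => ?_⟩
  unfold invEulerProd
  split_ifs
  · exact hC _ ⟨_, rfl⟩
  · simpa using hC0

/-! ### Jacobi's triple product -/

/-- The general term of the theta series, with `s ^ 2` as nome. -/
noncomputable def thetaTerm (s x : ℂ) (k : ℤ) : ℂ :=
  (-1) ^ k * s ^ (k * k - k) * x ^ k

theorem thetaTerm_add_one {s x : ℂ} (hs : s ≠ 0) (hx : x ≠ 0) (k : ℤ) :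
    thetaTerm s x (k + 1) = -((s ^ 2) ^ k * x * thetaTerm s x k) := by
  have h1 : (k + 1) * (k + 1) - (k + 1) = (k * k - k) + 2 * k := by ring
  have h2 : (s ^ 2) ^ k = s ^ (2 * k) := by rw [zpow_mul]; rfl
  rw [thetaTerm, thetaTerm, h1, h2, zpow_add₀ hs, zpow_add_one₀ hx, zpow_add_one₀ (by norm_num)]
  ring

theorem summable_thetaTerm {s x : ℂ} (hs : s ≠ 0) (hs1 : ‖s‖ < 1) (hx : x ≠ 0) :
    Summable fun k => ‖thetaTerm s x k‖ := by
  have hI : (Real.pi : ℂ) * Complex.I ≠ 0 := by simp [Real.pi_ne_zero]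
  have hpi : (Real.pi : ℂ) ≠ 0 := by simp [Real.pi_ne_zero]
  -- With `s = exp(πiτ)` and `-x/s = exp(2πiz)`, the term is that of the classical theta series, and
  -- `|s| < 1` means `Im τ > 0`.
  set τ : ℂ := Complex.log s / (Real.pi * Complex.I) with hτ
  set z : ℂ := Complex.log (-x / s) / (2 * Real.pi * Complex.I) with hz
  have hτ0 : 0 < τ.im := by
    have h1 : τ = ((-1 / Real.pi : ℝ) : ℂ) * (Complex.I * Complex.log s) := by
      rw [hτ]
      push_cast
      field_simp
      simp
    rw [h1, Complex.im_ofReal_mul, Complex.I_mul_im, Complex.log_re]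
    exact mul_pos_of_neg_of_neg (div_neg_of_neg_of_pos (by norm_num) Real.pi_pos)
      (Real.log_neg (norm_pos_iff.mpr hs) hs1)
  have := ((summable_jacobiTheta₂_term_iff z τ).mpr hτ0).norm
  refine this.congr fun k => ?_
  congr 1
  have e1 : Complex.exp (Complex.log s) = s := Complex.exp_log hs
  have e2 : Complex.exp (Complex.log (-x / s)) = -x / s :=
    Complex.exp_log (div_ne_zero (neg_ne_zero.mpr hx) hs)
  have h3 : 2 * Real.pi * Complex.I * k * z + Real.pi * Complex.I * k ^ 2 * τ =
      k * Complex.log (-x / s) + ((k * k : ℤ) : ℂ) * Complex.log s := by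
    rw [hτ, hz]; push_cast; field_simp
  rw [jacobiTheta₂_term, h3, Complex.exp_add, Complex.exp_int_mul, Complex.exp_int_mul, e1, e2,
    thetaTerm, zpow_sub₀ hs, div_zpow, neg_eq_neg_one_mul x, mul_zpow]
  ring

/-- Finite form of Jacobi's triple product identity. -/
theorem hasSum_finite_triple_product {s x : ℂ} (hs : s ≠ 0) (hs1 : ‖s ^ 2‖ < 1) (hx : x ≠ 0)
    (n : ℕ) :
    HasSum (fun k : ℤ => thetaTerm s x k *
        (invEulerProd (s ^ 2) (n + k) * invEulerProd (s ^ 2) (n - k)))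
      ((∏ j ∈ Finset.range n, ((1 - (s ^ 2) ^ j * x) * (1 - (s ^ 2) ^ (j + 1) / x))) /
        eulerProd (s ^ 2) (2 * n)) := by
  have hp0 : s ^ 2 ≠ 0 := pow_ne_zero 2 hs
  induction n with
  | zero =>
    convert hasSum_single (0 : ℤ) ?_ using 1
    · simp [thetaTerm, invEulerProd, eulerProd]
    · intro k hk
      rcases lt_or_gt_of_ne hk with h | h
      · rw [invEulerProd_of_neg (k := ((0 : ℕ) : ℤ) + k) _ (by simpa using h)]; simp
      · rw [invEulerProd_of_neg (k := ((0 : ℕ) : ℤ) - k) _ (by simpa using h)]; simp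
  | succ n ih =>
    have hm := (Equiv.hasSum_iff (Equiv.subRight (1 : ℤ))).mpr ih
    have hpl := (Equiv.hasSum_iff (Equiv.addRight (1 : ℤ))).mpr ih
    -- With `p = s²`, the new factor is `(1 - p^n x)(1 - p^{n+1}/x) = 1 + p^{2n+1} - p^n x -
    -- p^{n+1}/x`; the powers `x` and `1/x` shift the summation index by one. The divisor updates
    -- `(p;p)_{2n}` to `(p;p)_{2n+2}`.
    have key := ((ih.mul_left (1 + (s ^ 2) ^ (2 * n + 1))).sub
      ((hm.mul_left ((s ^ 2) ^ n * x)).add (hpl.mul_left ((s ^ 2) ^ (n + 1) / x)))).div_const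
      ((1 - (s ^ 2) ^ (2 * n + 1)) * (1 - (s ^ 2) ^ (2 * n + 2)))
    have d1 := one_sub_pow_ne_zero hs1 (i := 2 * n + 1) (by lia)
    have d2 := one_sub_pow_ne_zero hs1 (i := 2 * n + 2) (by lia)
    have d3 := eulerProd_ne_zero hs1 (2 * n)
    have aux : ∀ {f g : ℤ → ℂ} {u v : ℂ}, HasSum f u → f = g → u = v → HasSum g v := by
      rintro f g u v h rfl rfl
      exact h
    refine aux key (funext fun k => Eq.symm ?_) (Eq.symm ?_)
    · rw [eq_div_iff (mul_ne_zero d1 d2)]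
      simp only [Function.comp_apply, Equiv.subRight_apply, Equiv.coe_addRight]
      have hJ : thetaTerm s x k = -((s ^ 2) ^ (k - 1) * x * thetaTerm s x (k - 1)) := by
        simpa using thetaTerm_add_one hs hx (k - 1)
      have hJ' : thetaTerm s x (k - 1) = -((s ^ 2) ^ (1 - k) / x * thetaTerm s x k) := by
        have : (s ^ 2) ^ (1 - k) = ((s ^ 2) ^ (k - 1))⁻¹ := by rw [← zpow_neg]; congr 1; ring
        rw [hJ, this]
        have := zpow_ne_zero (k - 1) hp0
        field_simp
      rw [hJ', thetaTerm_add_one hs hx k]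
      have g1 := invEulerProd_sub_one hs1 (n + k + 1)
      have g2 := invEulerProd_sub_one hs1 (n + k)
      have g3 := invEulerProd_sub_one hs1 (n - k + 1)
      have g4 := invEulerProd_sub_one hs1 (n - k)
      generalize hpp : s ^ 2 = p at *
      have e1 : ((n + 1 : ℕ) : ℤ) + k = n + k + 1 := by push_cast; ring
      have e2 : ((n + 1 : ℕ) : ℤ) - k = n - k + 1 := by push_cast; ring
      have e3 : (n : ℤ) + (k - 1) = n + k - 1 := by ring
      have e4 : (n : ℤ) - (k - 1) = n - k + 1 := by ring
      have e5 : (n : ℤ) + (k + 1) = n + k + 1 := by ring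
      have e6 : (n : ℤ) - (k + 1) = n - k - 1 := by ring
      rw [add_sub_cancel_right] at g1 g3
      rw [e1, e2, e3, e4, e5, e6, g2, g4, g1, g3]
      have z1 : p ^ (n + k + 1 : ℤ) = p ^ n * p ^ k * p := by
        rw [zpow_add_one₀ hp0, zpow_add₀ hp0, zpow_natCast]
      have z2 : p ^ (n + k : ℤ) = p ^ n * p ^ k := by
        rw [zpow_add₀ hp0, zpow_natCast]
      have z3 : p ^ (n - k + 1 : ℤ) = p ^ n / p ^ k * p := by
        rw [zpow_add_one₀ hp0, zpow_sub₀ hp0, zpow_natCast]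
      have z4 : p ^ (n - k : ℤ) = p ^ n / p ^ k := by
        rw [zpow_sub₀ hp0, zpow_natCast]
      have z5 : p ^ (1 - k : ℤ) = p / p ^ k := by
        rw [zpow_sub₀ hp0, zpow_one]
      rw [z1, z2, z3, z4, z5]
      have hk := zpow_ne_zero k hp0
      generalize p ^ k = P at *
      field_simp
      ring
    · rw [Finset.prod_range_succ, eulerProd, show 2 * (n + 1) = 2 * n + 1 + 1 by ring,
        Finset.prod_range_succ, Finset.prod_range_succ, ← eulerProd]
      have d2' : 1 - (s ^ 2) ^ (2 * n + 1 + 1) ≠ 0 := d2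
      generalize hpp : s ^ 2 = p at *
      field_simp
      ring_nf

/-- Jacobi's triple product identity, up to the value of the constant. -/
theorem exists_theta_eq_tsum {s : ℂ} (hs : s ≠ 0) (hs1 : ‖s‖ < 1) :
    ∃ C : ℂ, ∀ x : ℂ, x ≠ 0 → theta (s ^ 2) x = C * ∑' k : ℤ, thetaTerm s x k := by
  have hp1 : ‖s ^ 2‖ < 1 := by
    rw [norm_pow]; exact pow_lt_one₀ (norm_nonneg s) hs1 two_ne_zero
  obtain ⟨e, he, hlim⟩ := exists_tendsto_eulerProd hp1
  have hlim' := tendsto_invEulerProd he hlim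
  obtain ⟨B, hB0, hB⟩ := exists_norm_invEulerProd_le hp1
  -- Let `n → ∞` in the finite identity: `e` is the limit of `(p;p)_{2n}`, and each `e⁻¹` that of a
  -- reciprocal in the summand. Boundedness of the reciprocals justifies the termwise limit.
  refine ⟨e * (e⁻¹ * e⁻¹), fun x hx => ?_⟩
  have h1 : Tendsto (fun n : ℕ => ∑' k : ℤ, thetaTerm s x k *
      (invEulerProd (s ^ 2) (n + k) * invEulerProd (s ^ 2) (n - k))) atTop
      (𝓝 (∑' k : ℤ, thetaTerm s x k * (e⁻¹ * e⁻¹))) := by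
    refine tendsto_tsum_of_dominated_convergence
      ((summable_thetaTerm hs hs1 hx).mul_right (B * B)) (fun k => ?_) (.of_forall fun n k => ?_)
    · refine Tendsto.const_mul _ (Tendsto.mul ?_ ?_)
      · exact hlim'.comp (tendsto_atTop_add_const_right _ k tendsto_natCast_atTop_atTop)
      · exact hlim'.comp (tendsto_atTop_add_const_right _ (-k) tendsto_natCast_atTop_atTop)
    · rw [norm_mul, norm_mul]
      gcongr
      · exact hB _
      · exact hB _
  have h2 : Tendsto (fun n : ℕ => eulerProd (s ^ 2) (2 * n)) atTop (𝓝 e) :=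
    hlim.comp (tendsto_id.const_mul_atTop' two_pos)
  have h3 := (multipliable_theta hp1 x).tendsto_prod_tprod_nat
  have h4 := tendsto_nhds_unique h3 ((h2.mul h1).congr fun n => ?_)
  · rw [theta, h4, tsum_mul_right]
    ring
  · rw [(hasSum_finite_triple_product hs hp1 hx n).tsum_eq,
      mul_div_cancel₀ _ (eulerProd_ne_zero hp1 _)]

/-! ### Rank two of theta products -/

/-- Splitting of `ℤ × ℤ` according to the parity of the sum of the coordinates. -/
noncomputable def paritySplit : (ℤ × ℤ) ⊕ (ℤ × ℤ) ≃ ℤ × ℤ :=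
  Equiv.ofBijective
    (Sum.elim (fun w => (w.1 + w.2, w.1 - w.2)) (fun w => (w.1 + w.2 + 1, w.1 - w.2))) <| by
    constructor
    · rintro (⟨u, v⟩ | ⟨u, v⟩) (⟨u', v'⟩ | ⟨u', v'⟩) h <;>
        simp only [Sum.elim_inl, Sum.elim_inr, Prod.mk.injEq] at h
      · rw [show u = u' by lia, show v = v' by lia]
      · lia
      · lia
      · rw [show u = u' by lia, show v = v' by lia]
    · rintro ⟨k, l⟩
      rcases Int.even_or_odd' (k + l) with ⟨u, h | h⟩
      · exact ⟨.inl (u, k - u), by simp; lia⟩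
      · exact ⟨.inr (u, k - u - 1), by simp; lia⟩

/-- For `k = u + v`, `l = u - v` one has `k² + l² = 2u² + 2v²`, while `a` carries the exponent `k +
l = 2u` and `ξ` the exponent `k - l = 2v`. So the variables separate, with the nome squared. -/
theorem thetaTerm_mul_thetaTerm_even {s a ξ : ℂ} (hs : s ≠ 0) (ha : a ≠ 0) (hξ : ξ ≠ 0)
    (u v : ℤ) :
    thetaTerm s (a * ξ) (u + v) * thetaTerm s (a * ξ⁻¹) (u - v) =
      thetaTerm (s ^ 2) (-a ^ 2) u * thetaTerm (s ^ 2) (-(s ^ 2 * ξ ^ 2)) v := by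
  have e1 : (-1 : ℂ) ^ (u + v) * (-1) ^ (u - v) = 1 := by
    rw [← zpow_add₀ (by norm_num), show u + v + (u - v) = 2 * u by ring, zpow_mul]; simp
  have e2 : s ^ ((u + v) * (u + v) - (u + v)) * s ^ ((u - v) * (u - v) - (u - v)) =
      (s ^ 2) ^ (u * u - u) * (s ^ 2) ^ (v * v - v) * (s ^ 2) ^ v := by
    rw [← zpow_add₀ hs, ← zpow_natCast s 2, ← zpow_mul, ← zpow_mul, ← zpow_mul, ← zpow_add₀ hs,
      ← zpow_add₀ hs]
    congr 1; push_cast; ring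
  have e3 : (a * ξ) ^ (u + v) * (a * ξ⁻¹) ^ (u - v) = (a ^ 2) ^ u * (ξ ^ 2) ^ v := by
    rw [mul_zpow, mul_zpow, inv_zpow', mul_mul_mul_comm, ← zpow_add₀ ha, ← zpow_add₀ hξ,
      ← zpow_natCast a 2, ← zpow_natCast ξ 2, ← zpow_mul, ← zpow_mul]
    congr 2 <;> (push_cast; ring)
  have e4 : ∀ k : ℤ, (-1 : ℂ) ^ k * (-1) ^ k = 1 := fun k => by
    rw [← mul_zpow]; simp
  simp only [thetaTerm, neg_eq_neg_one_mul (a ^ 2), neg_eq_neg_one_mul (s ^ 2 * ξ ^ 2), mul_zpow]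
  rw [mul_zpow, mul_zpow] at e3
  linear_combination
    (s ^ ((u + v) * (u + v) - (u + v)) * s ^ ((u - v) * (u - v) - (u - v)) *
      (a ^ (u + v) * ξ ^ (u + v) * (a ^ (u - v) * ξ⁻¹ ^ (u - v)))) * e1 +
    (a ^ (u + v) * ξ ^ (u + v) * (a ^ (u - v) * ξ⁻¹ ^ (u - v))) * e2 +
    ((s ^ 2) ^ (u * u - u) * (s ^ 2) ^ (v * v - v) * (s ^ 2) ^ v) * (e3 -
      (a ^ 2) ^ u * (ξ ^ 2) ^ v * (e4 u * ((-1) ^ v * (-1) ^ v) + e4 v))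

theorem thetaTerm_mul_thetaTerm_odd {s a ξ : ℂ} (hs : s ≠ 0) (ha : a ≠ 0) (hξ : ξ ≠ 0)
    (u v : ℤ) :
    thetaTerm s (a * ξ) (u + v + 1) * thetaTerm s (a * ξ⁻¹) (u - v) =
      -(a * ξ) * (thetaTerm (s ^ 2) (-(s ^ 2 * a ^ 2)) u *
        thetaTerm (s ^ 2) (-(s ^ 4 * ξ ^ 2)) v) := by
  have h1 : ∀ (x y : ℂ) (k : ℤ), thetaTerm (s ^ 2) (-(x * y)) k =
      x ^ k * thetaTerm (s ^ 2) (-y) k := fun x y k => by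
    rw [thetaTerm, thetaTerm, neg_mul_eq_mul_neg, mul_zpow]; ring
  rw [thetaTerm_add_one hs (mul_ne_zero ha hξ), neg_mul, mul_assoc,
    thetaTerm_mul_thetaTerm_even hs ha hξ, h1 (s ^ 2) (a ^ 2), show s ^ 4 * ξ ^ 2 = s ^ 2 * (s ^ 2 * ξ ^ 2) by ring,
    h1 (s ^ 2) (s ^ 2 * ξ ^ 2), zpow_add₀ (pow_ne_zero 2 hs)]
  ring

/-- Each parity class of the double sum factors into a function of `a` times a function of `ξ`,
which gives the two terms. -/
theorem tsum_thetaTerm_mul_tsum_thetaTerm {s a ξ : ℂ} (hs : s ≠ 0) (hs1 : ‖s‖ < 1) (ha : a ≠ 0)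
    (hξ : ξ ≠ 0) :
    (∑' k, thetaTerm s (a * ξ) k) * ∑' k, thetaTerm s (a * ξ⁻¹) k =
      (∑' k, thetaTerm (s ^ 2) (-a ^ 2) k) * (∑' k, thetaTerm (s ^ 2) (-(s ^ 2 * ξ ^ 2)) k) +
      -(a * ξ) * ((∑' k, thetaTerm (s ^ 2) (-(s ^ 2 * a ^ 2)) k) *
        ∑' k, thetaTerm (s ^ 2) (-(s ^ 4 * ξ ^ 2)) k) := by
  have hs2 : s ^ 2 ≠ 0 := pow_ne_zero 2 hs
  have hs3 : ‖s ^ 2‖ < 1 := by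
    rw [norm_pow]; exact pow_lt_one₀ (norm_nonneg s) hs1 two_ne_zero
  have hmul : ∀ {t x y : ℂ}, t ≠ 0 → ‖t‖ < 1 → x ≠ 0 → y ≠ 0 →
      HasSum (fun w : ℤ × ℤ => thetaTerm t x w.1 * thetaTerm t y w.2)
        ((∑' k, thetaTerm t x k) * ∑' k, thetaTerm t y k) := fun ht ht1 hx hy =>
    (summable_thetaTerm ht ht1 hx).of_norm.hasSum.mul (summable_thetaTerm ht ht1 hy).of_norm.hasSum
      (summable_mul_of_summable_norm (summable_thetaTerm ht ht1 hx) (summable_thetaTerm ht ht1 hy))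
  have h1 := hmul hs hs1 (mul_ne_zero ha hξ) (mul_ne_zero ha (inv_ne_zero hξ))
  have h2 := hmul hs2 hs3 (x := -a ^ 2) (y := -(s ^ 2 * ξ ^ 2)) (by simp [ha]) (by simp [hs, hξ])
  have h3 := (hmul hs2 hs3 (x := -(s ^ 2 * a ^ 2)) (y := -(s ^ 4 * ξ ^ 2)) (by simp [hs, ha])
    (by simp [hs, hξ])).mul_left (-(a * ξ))
  refine h1.unique ((Equiv.hasSum_iff paritySplit).mp (HasSum.sum ?_ ?_))
  · refine h2.congr_fun fun w => ?_
    exact thetaTerm_mul_thetaTerm_even hs ha hξ _ _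
  · refine h3.congr_fun fun w => ?_
    exact thetaTerm_mul_thetaTerm_odd hs ha hξ _ _

/-- As a function of `a` and `ξ`, the product `θ(aξ)θ(aξ⁻¹)` has rank two. -/
theorem exists_theta_mul_theta_eq {p : ℂ} (hp0 : p ≠ 0) (hp : ‖p‖ < 1) :
    ∃ u₁ u₂ v₁ v₂ : ℂ → ℂ, ∀ a ξ : ℂ, a ≠ 0 → ξ ≠ 0 →
      theta p (a * ξ) * theta p (a * ξ⁻¹) = u₁ a * v₁ ξ + u₂ a * v₂ ξ := by
  obtain ⟨s, rfl⟩ := IsAlgClosed.exists_pow_nat_eq p (n := 2) (by norm_num)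
  have hs : s ≠ 0 := by rintro rfl; simp at hp0
  have hs1 : ‖s‖ < 1 := by
    rw [norm_pow] at hp
    exact (pow_lt_one_iff_of_nonneg (norm_nonneg s) two_ne_zero).mp hp
  obtain ⟨C, hC⟩ := exists_theta_eq_tsum hs hs1
  refine ⟨fun a => C * C * ∑' k, thetaTerm (s ^ 2) (-a ^ 2) k,
    fun a => C * C * -a * ∑' k, thetaTerm (s ^ 2) (-(s ^ 2 * a ^ 2)) k,
    fun ξ => ∑' k, thetaTerm (s ^ 2) (-(s ^ 2 * ξ ^ 2)) k,
    fun ξ => ξ * ∑' k, thetaTerm (s ^ 2) (-(s ^ 4 * ξ ^ 2)) k, fun a ξ ha hξ => ?_⟩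
  rw [hC _ (mul_ne_zero ha hξ), hC _ (mul_ne_zero ha (inv_ne_zero hξ)), mul_mul_mul_comm,
    tsum_thetaTerm_mul_tsum_thetaTerm hs hs1 ha hξ]
  ring

/-! ### Zeros of theta, and interpolation by two functions `φ` -/

theorem theta_one (p : ℂ) : theta p 1 = 0 := by
  refine tprod_of_exists_eq_zero ⟨0, by simp⟩

theorem theta_zero_left (x : ℂ) : theta 0 x = 1 - x := by
  rw [theta, tprod_eq_mulSingle 0]
  · simp
  · intro j hj
    simp [hj]

/-- The zeros of `θ` are the integral powers of `p`. -/
theorem theta_ne_zero {p x : ℂ} (hp : ‖p‖ < 1)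
    (h : ∀ j : ℤ, (p = 0 → j = 0) → p ^ j * x ≠ 1) : theta p x ≠ 0 := by
  by_cases hp0 : p = 0
  · subst hp0
    rw [theta_zero_left, sub_ne_zero]
    simpa using (h 0 fun _ => rfl).symm
  have hs : Summable fun j : ℕ => ‖p‖ ^ j := summable_geometric_of_lt_one (norm_nonneg p) hp
  have h1 : Summable fun j : ℕ => ‖-(p ^ j * x)‖ := by
    simpa [norm_mul, norm_pow] using hs.mul_right ‖x‖
  have h2 : Summable fun j : ℕ => ‖-(p ^ (j + 1) / x)‖ := by
    simpa [norm_div, norm_pow] using ((summable_nat_add_iff 1).mpr hs).div_const ‖x‖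
  have e : theta p x = (∏' j : ℕ, (1 + -(p ^ j * x))) * ∏' j : ℕ, (1 + -(p ^ (j + 1) / x)) := by
    rw [← (multipliable_one_add_of_summable h1).tprod_mul (multipliable_one_add_of_summable h2)]
    simp only [theta, sub_eq_add_neg]
  rw [e]
  refine mul_ne_zero (tprod_one_add_ne_zero_of_summable (fun j hj => ?_) h1)
    (tprod_one_add_ne_zero_of_summable (fun j hj => ?_) h2)
  · refine h j (fun h => absurd h hp0) ?_
    rw [zpow_natCast]
    linear_combination -hj
  · have hx : x ≠ 0 := by rintro rfl; simp at hj
    refine h (-((j + 1 : ℕ) : ℤ)) (fun h => absurd h hp0) ?_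
    have hpj : p ^ (j + 1) ≠ 0 := pow_ne_zero _ hp0
    have h3 : p ^ (j + 1) = x := by
      have : p ^ (j + 1) / x = 1 := by linear_combination -hj
      rwa [div_eq_one_iff_eq hx] at this
    rw [zpow_neg, zpow_natCast, ← h3, inv_mul_cancel₀ hpj]

/-- `φ(x;a) = θ(aξ)θ(aξ⁻¹)`, where `ξ + ξ⁻¹ = x`. -/
noncomputable def thetaPair (p a x : ℂ) : ℂ :=
  theta p (a * xi x) * theta p (a * (xi x)⁻¹)

theorem thetaPair_add_inv (p a : ℂ) {ξ : ℂ} (hξ : ξ ≠ 0) :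
    thetaPair p a (ξ + ξ⁻¹) = theta p (a * ξ) * theta p (a * ξ⁻¹) := by
  simpa [h, ellFact, thetaPair] using h_add_inv 1 p 1 a hξ

theorem h_eq_prod (q p : ℂ) (k : ℕ) (a x : ℂ) :
    h q p k a x = ∏ j ∈ Finset.range k, thetaPair p (a * q ^ j) x := by
  simp only [h, ellFact, thetaPair, ← Finset.prod_mul_distrib]
  refine Finset.prod_congr rfl fun j _ => ?_
  congr 2 <;> ring

/-- Any `φ(·;a)` is a combination of `φ(·;b)` and `φ(·;c)`, if `b` and `c` are in general
position. -/
theorem exists_thetaPair_eq {p : ℂ} (hp : ‖p‖ < 1) {a b c : ℂ} (ha : p ≠ 0 → a ≠ 0)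
    (hb : p ≠ 0 → b ≠ 0) (hc : p ≠ 0 → c ≠ 0)
    (hbc : ∀ j : ℤ, (p = 0 → j = 0) → p ^ j * b ≠ c)
    (hbc' : ∀ j : ℤ, (p = 0 → j = 0) → p ^ j * (b * c) ≠ 1) :
    ∃ A B : ℂ, ∀ x, thetaPair p a x = A * thetaPair p b x + B * thetaPair p c x := by
  by_cases hp0 : p = 0
  · subst hp0
    have h1 : c - b ≠ 0 := sub_ne_zero.mpr (by simpa using (hbc 0 fun _ => rfl).symm)
    have h2 : 1 - b * c ≠ 0 := sub_ne_zero.mpr (by simpa using (hbc' 0 fun _ => rfl).symm)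
    have e : ∀ t x : ℂ, thetaPair 0 t x = 1 + t ^ 2 - t * x := fun t x => by
      rw [thetaPair, theta_zero_left, theta_zero_left]
      linear_combination -t * xi_add_inv x + t ^ 2 * mul_inv_cancel₀ (xi_ne_zero x)
    refine ⟨(c - a) * (1 - a * c) / ((c - b) * (1 - b * c)),
      -((b - a) * (1 - a * b)) / ((c - b) * (1 - b * c)), fun x => ?_⟩
    rw [e, e, e, div_mul_eq_mul_div, div_mul_eq_mul_div, ← add_div, eq_div_iff (mul_ne_zero h1 h2)]
    ring
  · have ha := ha hp0
    have hb := hb hp0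
    have hc := hc hp0
    obtain ⟨u₁, u₂, v₁, v₂, H⟩ := exists_theta_mul_theta_eq hp0 hp
    have n1 : theta p (b * c) ≠ 0 := theta_ne_zero hp hbc'
    have n2 : theta p (b * c⁻¹) ≠ 0 := theta_ne_zero hp fun j hj h => hbc j hj <| by
      field_simp at h
      exact h
    have n3 : theta p (c * b⁻¹) ≠ 0 := theta_ne_zero hp fun j hj h =>
      hbc (-j) (fun h => absurd h hp0) <| by
        have := zpow_ne_zero j hp0
        rw [zpow_neg]
        field_simp at h ⊢
        exact h.symm
    have m1 := mul_ne_zero n1 n2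
    have m2 := mul_ne_zero n1 n3
    -- The function `φ(·;t)` vanishes at `ξ = t`. Evaluating the desired relation at `ξ = c` and at
    -- `ξ = b` therefore determines `A` and `B`.
    have z : ∀ {t : ℂ}, t ≠ 0 → u₁ t * v₁ t + u₂ t * v₂ t = 0 := fun {t} ht => by
      rw [← H t t ht ht, mul_inv_cancel₀ ht, theta_one, mul_zero]
    rw [H b c hb hc] at m1
    rw [mul_comm b c, H c b hc hb] at m2
    refine ⟨(u₁ a * v₁ c + u₂ a * v₂ c) / (u₁ b * v₁ c + u₂ b * v₂ c),
      (u₁ a * v₁ b + u₂ a * v₂ b) / (u₁ c * v₁ b + u₂ c * v₂ b), fun x => ?_⟩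
    have hx := xi_ne_zero x
    simp only [thetaPair]
    rw [H a _ ha hx, H b _ hb hx, H c _ hc hx, div_mul_eq_mul_div, div_mul_eq_mul_div,
      div_add_div _ _ m1 m2, eq_div_iff (mul_ne_zero m1 m2)]
    have zb := z hb
    have zc := z hc
    generalize v₁ (xi x) = w₁
    generalize v₂ (xi x) = w₂
    linear_combination ((u₁ a * w₁ + u₂ a * w₂) * (u₁ c * v₁ c + u₂ c * v₂ c) -
      (u₁ a * v₁ c + u₂ a * v₂ c) * (u₁ c * w₁ + u₂ c * w₂)) * zb -
      (u₁ a * v₁ b + u₂ a * v₂ b) * (u₁ b * w₁ + u₂ b * w₂) * zc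

/-! ### Genericity and spanning -/

/-- The genericity condition ensuring that the functions `h_l(x;c) h_{N-l}(x;d)`, `0 ≤ l ≤ N`,
are linearly independent. -/
structure IsGeneric (q p : ℂ) (N : ℕ) (c d : ℂ) : Prop where
  ne : ∀ j s : ℤ, (p = 0 → j = 0) → 1 - (N : ℤ) ≤ s → s ≤ (N : ℤ) - 1 → p ^ j * c ≠ q ^ s * d
  mul_ne : ∀ j s : ℤ, (p = 0 → j = 0) → 1 - (N : ℤ) ≤ s → s ≤ 0 → p ^ j * (c * d) ≠ q ^ s

theorem IsGeneric.mono {q p : ℂ} {N M : ℕ} {c d : ℂ} (hMN : M ≤ N) (hg : IsGeneric q p N c d) :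
    IsGeneric q p M c d :=
  ⟨fun j s hj h1 h2 => hg.ne j s hj (by lia) (by lia),
    fun j s hj h1 h2 => hg.mul_ne j s hj (by lia) h2⟩

/-- The shift moves the exponent `s` by `l - k` in the first condition and by `-k - l` in the
second; `k + l + M = N` keeps both inside the original ranges. -/
theorem IsGeneric.shift {q p : ℂ} {N k l M : ℕ} {c d : ℂ} (hq : q ≠ 0)
    (hN : k + l + M = N) (hg : IsGeneric q p N c d) :
    IsGeneric q p M (c * q ^ k) (d * q ^ l) := by
  constructor
  · intro j s hj h1 h2 h
    refine hg.ne j (s + l - k) hj (by lia) (by lia) ?_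
    rw [zpow_sub₀ hq, zpow_add₀ hq, zpow_natCast, zpow_natCast, div_mul_eq_mul_div,
      eq_div_iff (pow_ne_zero k hq)]
    linear_combination h
  · intro j s hj h1 h2 h
    refine hg.mul_ne j (s - k - l) hj (by lia) (by lia) ?_
    rw [zpow_sub₀ hq, zpow_sub₀ hq, zpow_natCast, zpow_natCast, div_div,
      eq_div_iff (mul_ne_zero (pow_ne_zero k hq) (pow_ne_zero l hq))]
    linear_combination h

theorem h_zero (q p a x : ℂ) : h q p 0 a x = 1 := by simp [h_eq_prod]

theorem h_add (q p : ℂ) (k l : ℕ) (a x : ℂ) :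
    h q p (k + l) a x = h q p k a x * h q p l (a * q ^ k) x := by
  simp only [h_eq_prod, Finset.prod_range_add, pow_add, mul_assoc]

theorem h_succ (q p : ℂ) (k : ℕ) (a x : ℂ) :
    h q p (k + 1) a x = h q p k a x * thetaPair p (a * q ^ k) x := by
  rw [h_eq_prod, h_eq_prod, Finset.prod_range_succ]

/-- Every product of `M` functions `φ(·;a)` is in the span of the functions
`h_l(·;c) h_{M-l}(·;d)`. -/
theorem prod_thetaPair_mem_span {q p : ℂ} (hq : q ≠ 0) (hp : ‖p‖ < 1) {ι : Type*} (t : Finset ι)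
    (a : ι → ℂ) (ha : ∀ i ∈ t, p ≠ 0 → a i ≠ 0) {c d : ℂ} (hc : p ≠ 0 → c ≠ 0)
    (hd : p ≠ 0 → d ≠ 0) (hg : IsGeneric q p t.card c d) :
    (fun x => ∏ i ∈ t, thetaPair p (a i) x) ∈
      Submodule.span ℂ {f | ∃ l ≤ t.card, f = hh q p t.card l c d} := by
  classical
  induction t using Finset.induction_on with
  | empty =>
    refine Submodule.subset_span ⟨0, le_rfl, ?_⟩
    funext x
    simp [hh, h_zero]
  | insert i t hi ih =>
    rw [Finset.card_insert_of_notMem hi] at hg ⊢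
    have h1 := ih (fun j hj => ha j (Finset.mem_insert_of_mem hj)) (hg.mono (Nat.le_succ _))
    have h2 : (fun x => ∏ j ∈ insert i t, thetaPair p (a j) x) =
        LinearMap.mulLeft ℂ (thetaPair p (a i)) (fun x => ∏ j ∈ t, thetaPair p (a j) x) := by
      funext x
      simp [Finset.prod_insert hi]
    rw [h2]
    rw [← Submodule.mem_comap]
    refine Submodule.span_le.mpr ?_ h1
    rintro _ ⟨l, hl, rfl⟩
    obtain ⟨k, hk⟩ := Nat.exists_eq_add_of_le hl
    -- For `M = 1` only `s = 0` remains, which is the general position needed of `cq^l` and `dq^k`.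
    have hg' := hg.shift hq (k := l) (l := k) (M := 1) (by lia)
    obtain ⟨A, B, hAB⟩ := exists_thetaPair_eq hp (ha i (Finset.mem_insert_self i t))
      (b := c * q ^ l) (c := d * q ^ k)
      (fun h => mul_ne_zero (hc h) (pow_ne_zero l hq))
      (fun h => mul_ne_zero (hd h) (pow_ne_zero k hq))
      (fun j hj => by simpa using hg'.ne j 0 hj (by simp) (by simp))
      (fun j hj => by simpa using hg'.mul_ne j 0 hj (by simp) (by simp))
    -- The points `cq^l` and `dq^k` are chosen because their functions `φ` are the next factors of
    -- `h_l(·;c)` and `h_k(·;d)`.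
    have h3 : LinearMap.mulLeft ℂ (thetaPair p (a i)) (hh q p t.card l c d) =
        A • hh q p (t.card + 1) (l + 1) c d + B • hh q p (t.card + 1) l c d := by
      funext x
      simp only [LinearMap.mulLeft_apply, Pi.mul_apply, Pi.add_apply, Pi.smul_apply, smul_eq_mul,
        hh, hAB]
      rw [hk, show l + k + 1 - (l + 1) = k by lia, show l + k + 1 - l = k + 1 by lia,
        show l + k - l = k by lia, h_succ, h_succ]
      ring
    rw [SetLike.mem_coe, Submodule.mem_comap, h3]
    exact add_mem (Submodule.smul_mem _ _ (Submodule.subset_span ⟨l + 1, by lia, rfl⟩))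
      (Submodule.smul_mem _ _ (Submodule.subset_span ⟨l, by lia, rfl⟩))

/-! ### Linear independence -/

/-- There are arbitrarily many points in general position. -/
theorem exists_generic_points {p : ℂ} (hp : ‖p‖ < 1) (N : ℕ) :
    ∃ e : Fin (N + 1) → ℂ, (∀ i, e i ≠ 0) ∧ ∀ i j,
      thetaPair p (e j) (e i + (e i)⁻¹) = 0 ↔ j = i := by
  -- Points on the unit circle avoid all `p^j` with `j ≠ 0`. The products `e_i e_j` have exponents
  -- from `2` to `2N + 2`, so order `2N + 3` keeps them different from `1`.
  have hprim := Complex.isPrimitiveRoot_exp (2 * N + 3) (by lia)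
  generalize Complex.exp (2 * Real.pi * Complex.I / (2 * N + 3 : ℕ)) = ζ at hprim
  have hn : ‖ζ‖ = 1 := hprim.norm'_eq_one (by lia)
  have h0 : ζ ≠ 0 := hprim.ne_zero (by lia)
  have hth : ∀ z : ℂ, ‖z‖ = 1 → z ≠ 1 → theta p z ≠ 0 := fun z hz hz1 =>
    theta_ne_zero hp fun j hj h => by
      rcases eq_or_ne j 0 with rfl | hj0
      · exact hz1 (by simpa using h)
      · have hp0 : 0 < ‖p‖ := norm_pos_iff.mpr fun h => hj0 (hj h)
        have h2 : ‖p‖ ^ j = 1 := by simpa [hz] using congrArg norm h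
        exact hj0 ((zpow_eq_one_iff_right₀ hp0.le hp.ne).mp h2)
  refine ⟨fun i => ζ ^ ((i : ℕ) + 1), fun i => pow_ne_zero _ h0, fun i j => ⟨fun h => ?_, ?_⟩⟩
  · rw [thetaPair_add_inv p _ (pow_ne_zero _ h0)] at h
    by_contra hij
    have hij' : (j : ℕ) ≠ i := fun h => hij (Fin.ext h)
    have hi := i.isLt
    have hj := j.isLt
    rcases mul_eq_zero.mp h with h1 | h1
    · refine hth _ (by simp [hn]) ?_ h1
      rw [← pow_add]
      exact hprim.pow_ne_one_of_pos_of_lt (by lia) (by lia)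
    · refine hth _ (by simp [hn]) (fun h2 => hij' ?_) h1
      have := hprim.pow_inj (i := (j : ℕ) + 1) (j := (i : ℕ) + 1) (by lia) (by lia)
        (mul_inv_eq_one₀ (pow_ne_zero _ h0) |>.mp h2)
      lia
  · rintro rfl
    rw [thetaPair_add_inv p _ (pow_ne_zero _ h0), mul_inv_cancel₀ (pow_ne_zero _ h0), theta_one,
      mul_zero]

theorem linearIndependent_hh {q p : ℂ} (hq : q ≠ 0) (hp : ‖p‖ < 1) {N : ℕ} {c d : ℂ}
    (hc : p ≠ 0 → c ≠ 0) (hd : p ≠ 0 → d ≠ 0) (hg : IsGeneric q p N c d) :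
    LinearIndependent ℂ fun l : Fin (N + 1) => hh q p N l c d := by
  obtain ⟨e, he0, he⟩ := exists_generic_points hp N
  let ev : (ℂ → ℂ) →ₗ[ℂ] (Fin (N + 1) → ℂ) :=
    LinearMap.funLeft ℂ ℂ fun i => e i + (e i)⁻¹
  -- After evaluation at `N + 1` points there are `N + 1` vectors in `ℂ^{N+1}`, so spanning
  -- suffices.
  refine LinearIndependent.of_comp ev
    (linearIndependent_of_top_le_span_of_card_eq_finrank ?_ (by simp))
  rw [← Pi.basisFun ℂ (Fin (N + 1)) |>.span_eq, Submodule.span_le]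
  rintro _ ⟨i, rfl⟩
  have hcard : (Finset.univ.erase i).card = N := by simp
  have h1 := prod_thetaPair_mem_span hq hp (Finset.univ.erase i) e (fun j _ _ => he0 j) hc hd
    (by rwa [hcard])
  rw [hcard] at h1
  have h2 := Submodule.mem_map_of_mem (f := ev) h1
  rw [Submodule.map_span] at h2
  have h3 : ev '' {f | ∃ l ≤ N, f = hh q p N l c d} ⊆
      Set.range (ev ∘ fun l : Fin (N + 1) => hh q p N l c d) := by
    rintro _ ⟨_, ⟨l, hl, rfl⟩, rfl⟩
    exact ⟨⟨l, by lia⟩, rfl⟩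
  have h4 := Submodule.span_mono h3 h2
  set L : ℂ := ∏ j ∈ Finset.univ.erase i, thetaPair p (e j) (e i + (e i)⁻¹)
  have hL : L ≠ 0 := Finset.prod_ne_zero_iff.mpr fun j hj h =>
    (Finset.mem_erase.mp hj).1 ((he i j).mp h)
  -- Lagrange interpolation: the product over `j ≠ i` vanishes at every chosen point except the
  -- `i`-th.
  have h5 : Pi.basisFun ℂ (Fin (N + 1)) i =
      L⁻¹ • ev fun x => ∏ j ∈ Finset.univ.erase i, thetaPair p (e j) x := by
    funext k
    rw [Pi.basisFun_apply, Pi.smul_apply, smul_eq_mul, LinearMap.funLeft_apply]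
    rcases eq_or_ne k i with rfl | hk
    · rw [Pi.single_eq_same, inv_mul_cancel₀ hL]
    · rw [Pi.single_eq_of_ne hk, Finset.prod_eq_zero (Finset.mem_erase.mpr ⟨hk, Finset.mem_univ k⟩)
        ((he k k).mpr rfl), mul_zero]
  rw [SetLike.mem_coe, h5]
  exact Submodule.smul_mem _ _ h4

/-! ### Band structure and coefficients -/

/-- The band structure: in the expansion of `h_k(·;a) h_{N-k}(·;b)` in the functions
`h_l(·;aq^m) h_{N-l}(·;bq^n)`, only the terms with `k - m ≤ l ≤ k + n` occur. -/
theorem hh_mem_span {q p : ℂ} (hq : q ≠ 0) (hp : ‖p‖ < 1) {N m n : ℕ} {a b : ℂ}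
    (ha : p ≠ 0 → a ≠ 0) (hb : p ≠ 0 → b ≠ 0)
    (hg : IsGeneric q p N (a * q ^ m) (b * q ^ n)) {k : ℕ} (hk : k ≤ N) :
    hh q p N k a b ∈ Submodule.span ℂ
      {f : ℂ → ℂ | ∃ l : ℕ, l ≤ N ∧ (k : ℤ) - m ≤ l ∧ (l : ℤ) ≤ k + n ∧
        f = hh q p N l (a * q ^ m) (b * q ^ n)} := by
  -- Here `k₁ = min(k, m)` counts the factors of `h_k(·;a)` to be expanded, and `k₀ = k - k₁` those
  -- already shared with base `aq^m`; likewise `n₁ = min(N - k, n)` and `n₀` for `b`.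
  obtain ⟨k₀, k₁, hk₀⟩ : ∃ k₀ k₁ : ℕ, k = k₁ + k₀ ∧ k ≤ k₀ + m ∧ (k₀ = 0 ∨ k₁ = m) :=
    ⟨k - m, k - (k - m), by lia⟩
  obtain ⟨n₀, n₁, hn₀⟩ : ∃ n₀ n₁ : ℕ, N - k = n₁ + n₀ ∧ N ≤ n₀ + n + k ∧ (n₀ = 0 ∨ n₁ = n) :=
    ⟨N - k - n, N - k - (N - k - n), by lia⟩
  have hsplit : ∀ (a x : ℂ) (m k₀ k₁ : ℕ), (k₀ = 0 ∨ k₁ = m) →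
      h q p (k₁ + k₀) a x = h q p k₁ a x * h q p k₀ (a * q ^ m) x := by
    rintro a x m k₀ k₁ (rfl | rfl)
    · simp [h_zero]
    · exact h_add q p k₁ k₀ a x
  let A : Fin k₁ ⊕ Fin n₁ → ℂ := Sum.elim (fun i => a * q ^ (i : ℕ)) (fun i => b * q ^ (i : ℕ))
  have hq' : ∀ i : ℕ, q ^ i ≠ 0 := fun i => pow_ne_zero i hq
  have hcard : (Finset.univ : Finset (Fin k₁ ⊕ Fin n₁)).card = k₁ + n₁ := by simp
  have h1 := prod_thetaPair_mem_span hq hp Finset.univ A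
    (by rintro (i | i) _ h <;> simp [A, ha h, hb h, hq])
    (c := a * q ^ m * q ^ k₀) (d := b * q ^ n * q ^ n₀)
    (fun h => mul_ne_zero (mul_ne_zero (ha h) (hq' _)) (hq' _))
    (fun h => mul_ne_zero (mul_ne_zero (hb h) (hq' _)) (hq' _))
    (by rw [hcard]; exact hg.shift hq (by lia))
  rw [hcard] at h1
  have h2 : hh q p N k a b =
      LinearMap.mulLeft ℂ (fun x => h q p k₀ (a * q ^ m) x * h q p n₀ (b * q ^ n) x)
        (fun x => ∏ i, thetaPair p (A i) x) := by
    funext x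
    simp only [LinearMap.mulLeft_apply, Pi.mul_apply, hh, Fintype.prod_sum_type, A, Sum.elim_inl,
      Sum.elim_inr]
    rw [Fin.prod_univ_eq_prod_range (fun i => thetaPair p (a * q ^ i) x),
      Fin.prod_univ_eq_prod_range (fun i => thetaPair p (b * q ^ i) x), ← h_eq_prod, ← h_eq_prod,
      hn₀.1, hk₀.1, hsplit a x m k₀ k₁ hk₀.2.2, hsplit b x n n₀ n₁ hn₀.2.2]
    ring
  rw [h2]
  rw [← Submodule.mem_comap]
  refine Submodule.span_le.mpr ?_ h1
  rintro _ ⟨l, hl, rfl⟩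
  rw [SetLike.mem_coe, Submodule.mem_comap]
  -- Restoring the common factors turns index `l` into `k₀ + l` with `0 ≤ l ≤ k₁ + n₁`; since `k₀ ≥
  -- k - m` and `k₀ + k₁ + n₁ ≤ k + n`, this is the band.
  refine Submodule.subset_span ⟨k₀ + l, by lia, by lia, by lia, ?_⟩
  funext x
  simp only [LinearMap.mulLeft_apply, Pi.mul_apply, hh]
  rw [show N - (k₀ + l) = n₀ + (k₁ + n₁ - l) by lia, h_add, h_add]
  ring

theorem exists_coeff_of_mem_span {ι E : Type*} [Fintype ι] [AddCommGroup E] [Module ℂ E]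
    (F : ι → E) (P : ι → Prop) {f : E} (hf : f ∈ Submodule.span ℂ {g | ∃ i, P i ∧ g = F i}) :
    ∃ r : ι → ℂ, (∀ i, ¬ P i → r i = 0) ∧ f = ∑ i, r i • F i := by
  classical
  induction hf using Submodule.span_induction with
  | mem g hg =>
    obtain ⟨i, hi, rfl⟩ := hg
    refine ⟨Pi.single i 1, fun j hj => Pi.single_eq_of_ne (by rintro rfl; exact hj hi) _, ?_⟩
    rw [Finset.sum_eq_single i] <;> simp +contextual
  | zero => exact ⟨0, by simp, by simp⟩
  | add g g' _ _ hg hg' =>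
    obtain ⟨r, hr, rfl⟩ := hg
    obtain ⟨r', hr', rfl⟩ := hg'
    exact ⟨r + r', fun i hi => by simp [hr i hi, hr' i hi],
      by simp [add_smul, Finset.sum_add_distrib]⟩
  | smul z g _ hg =>
    obtain ⟨r, hr, rfl⟩ := hg
    exact ⟨z • r, fun i hi => by simp [hr i hi], by simp [Finset.smul_sum, mul_smul]⟩

end EllipticSixJ

theorem mainTheorem8 (q p : ℂ) (hq : q ≠ 0) (hp : ‖p‖ < 1) (N m n : ℕ) (a b : ℂ)
    (hab : p ≠ 0 → a ≠ 0 ∧ b ≠ 0)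
    (hquot : ∀ j s : ℤ, (p = 0 → j = 0) → 1 - (N : ℤ) ≤ s → s ≤ (N : ℤ) - 1 →
      p ^ j * (a * q ^ m) ≠ q ^ s * (b * q ^ n))
    (hprod : ∀ j s : ℤ, (p = 0 → j = 0) → 1 - (N : ℤ) ≤ s → s ≤ 0 →
      p ^ j * ((a * q ^ m) * (b * q ^ n)) ≠ q ^ s) :
    (∀ k : ℕ, k ≤ N →
      EllipticSixJ.hh q p N k a b ∈ Submodule.span ℂ
        {f : ℂ → ℂ | ∃ l : ℕ, l ≤ N ∧ (k : ℤ) - m ≤ l ∧ (l : ℤ) ≤ k + n ∧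
          f = EllipticSixJ.hh q p N l (a * q ^ m) (b * q ^ n)}) ∧
    (∃! R : Fin (N + 1) → Fin (N + 1) → ℂ,
      EllipticSixJ.IsSixJ q p N a b (a * q ^ m) (b * q ^ n) R) ∧
    (∀ R : Fin (N + 1) → Fin (N + 1) → ℂ,
      EllipticSixJ.IsSixJ q p N a b (a * q ^ m) (b * q ^ n) R →
      ∀ k l : Fin (N + 1),
        ¬ (((k : ℕ) : ℤ) - m ≤ ((l : ℕ) : ℤ) ∧ ((l : ℕ) : ℤ) ≤ ((k : ℕ) : ℤ) + n) →
        R k l = 0) := by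
  have ha : p ≠ 0 → a ≠ 0 := fun h => (hab h).1
  have hb : p ≠ 0 → b ≠ 0 := fun h => (hab h).2
  have hg : EllipticSixJ.IsGeneric q p N (a * q ^ m) (b * q ^ n) := ⟨hquot, hprod⟩
  have hspan := fun (k : ℕ) (hk : k ≤ N) => EllipticSixJ.hh_mem_span hq hp ha hb hg hk
  have hli := EllipticSixJ.linearIndependent_hh hq hp
    (fun h => mul_ne_zero (ha h) (pow_ne_zero m hq))
    (fun h => mul_ne_zero (hb h) (pow_ne_zero n hq)) hg
  have hcoeff : ∀ k : Fin (N + 1), ∃ r : Fin (N + 1) → ℂ,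
      (∀ l : Fin (N + 1), ¬ (((k : ℕ) : ℤ) - m ≤ ((l : ℕ) : ℤ) ∧
        ((l : ℕ) : ℤ) ≤ ((k : ℕ) : ℤ) + n) → r l = 0) ∧
      EllipticSixJ.hh q p N k a b =
        ∑ l, r l • EllipticSixJ.hh q p N l (a * q ^ m) (b * q ^ n) := fun k => by
    refine EllipticSixJ.exists_coeff_of_mem_span _
      (fun l : Fin (N + 1) => ((k : ℕ) : ℤ) - m ≤ ((l : ℕ) : ℤ) ∧
        ((l : ℕ) : ℤ) ≤ ((k : ℕ) : ℤ) + n) (Submodule.span_mono ?_ (hspan k (by lia)))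
    rintro _ ⟨l, hl, h1, h2, rfl⟩
    exact ⟨⟨l, by lia⟩, ⟨h1, h2⟩, rfl⟩
  choose R hR0 hR using hcoeff
  -- Uniqueness identifies every solution with the banded `R`, so the vanishing holds for any
  -- solution.
  have huniq : ∀ R' : Fin (N + 1) → Fin (N + 1) → ℂ,
      EllipticSixJ.IsSixJ q p N a b (a * q ^ m) (b * q ^ n) R' → R' = R := fun R' h' => by
    funext k l
    refine congrFun (hli.fintypeLinearCombination_injective ?_) l
    rw [Fintype.linearCombination_apply, Fintype.linearCombination_apply, ← hR k]
    funext x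
    simpa using (h' k x).symm
  refine ⟨hspan, ⟨R, fun k x => by simpa using congrFun (hR k) x, huniq⟩, fun R' h' k l hkl => ?_⟩
  rw [huniq R' h']
  exact hR0 k l hkl
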